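/- Setup. A UAV hovers at altitude $h\ge 0$ above the origin O of the ground plane. A destination D on the ground has polar coordinates $(r_D,\varphi_D)$. Let $K\ge 0$ be a non-decreasing and $\alpha$ a non-increasing real function on $[0,\pi/2]$ (Rician factor and path loss exponent as functions of the elevation angle), $\kappa_0=K(0)$, $\alpha_0=\alpha(0)$, let $A,P_U,P_R,N_0,\xi>0$ (link constant, transmit powers of the UAV and of each relay, noise power, SNR threshold), and put $\gamma_U=AP_U/N_0$, $\gamma_R=AP_R/N_0$. Relays $R_1,R_2,\dots$ form a Poisson point process of constant density $\lambda\ge 0$ in the disk $\mathcal C$ of radius $r_{\mathcal C}\geq 0$ centred at O. For a relay R with polar coordinates $(r_R,\varphi_R)$ let $$\theta_R=\arctan(h/r_R),\quad \ell_{UR}=\sqrt{r_R^2+h^2},\quad \ell_{RD}=\sqrt{r_R^2+r_D^2-2r_Rr_D\cos(\varphi_R-\varphi_D)},$$ and let the instantaneous SNRs be $$\Gamma_{UR}=\frac{AP_U}{N_0\,\ell_{UR}^{\alpha(\theta_R)}}\,\Omega_{UR},\qquad \Gamma_{RD}=\frac{AP_R}{N_0\,\ell_{RD}^{\alpha_0}}\,\Omega_{RD}.$$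 Given the locations of the relays, all the fading powers $\Omega_{UR},\Omega_{RD}$ (over all relays) are independent, and each has the unit-mean Rician power density $$f(\omega)=(k+1)e^{-k}e^{-(k+1)\omega}I_0\!\left(2\sqrt{k(k+1)\omega}\right),\qquad \omega\ge 0,$$ with $k=K(\theta_R)$ for $\Omega_{UR}$ and $k=\kappa_0$ for $\Omega_{RD}$, where $I_0$ is the modified Bessel function of the first kind of order zero. The set of decoding relays is $\mathcal A=\{R_j:\Gamma_{UR_j}>\xi\}$, and the relay $R_J\in\mathcal A$ with the largest $\Gamma_{R_jD}$ retransmits to D. The relaying outage probability is $P_{\rm out}^{\rm rc}(r_D,h)=\mathbb P(\Gamma_{R_JD}\le\xi)$, where the event is understood to occur when $\mathcal A=\emptyset$ (nothing is retransmitted, $\Gamma_{R_JD}=0$). Theorem. With the first order Marcum Q-function $Q(a,b)=\int_b^\infty x\,e^{-(x^2+a^2)/2}I_0(ax)\,dx$, $$P_{\rm out}^{\rm rc}(r_D,h)=e^{-\lambda[\psi_1(h)-\psi_2(r_D,h)]},$$ where $$\psi_1(h)=2\pi\int_0^{r_{\mathcal C}} r_R\,Q\!\left(\sqrt{2K(\theta_R)},\sqrt{2[K(\theta_R)+1]\,\xi\,\ell_{UR}^{\alpha(\theta_R)}/\gamma_U}\right)dr_R,$$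 $$\psi_2(r_D,h)=\int_0^{2\pi}\!\!\int_0^{r_{\mathcal C}} r_R\left[1-Q\!\left(\sqrt{2\kappa_0},\sqrt{2(\kappa_0+1)\,\xi\,\ell_{RD}^{\alpha_0}/\gamma_R}\right)\right]Q\!\left(\sqrt{2K(\theta_R)},\sqrt{2[K(\theta_R)+1]\,\xi\,\ell_{UR}^{\alpha(\theta_R)}/\gamma_U}\right)dr_R\,d\varphi_R.$$ -/

import Mathlib

open MeasureTheory ProbabilityTheory Set

noncomputable section

/-- The modified Bessel function of the first kind and order zero,
`I₀(x) = ∑ₖ (x/2)^(2k) / (k!)²`. -/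
def besselI0 (x : ℝ) : ℝ := ∑' k : ℕ, (x / 2) ^ (2 * k) / (k.factorial : ℝ) ^ 2

/-- The first order Marcum Q-function `Q(a,b) = ∫_b^∞ x exp(-(x²+a²)/2) I₀(a x) dx`. -/
def marcumQ (a b : ℝ) : ℝ :=
  ∫ x in Ioi b, x * Real.exp (-(x ^ 2 + a ^ 2) / 2) * besselI0 (a * x)

/-- The density at `w ≥ 0` of the power of a Rician fading channel with Rician factor `K` and
unit mean power. -/
def ricianPowerPDF (K w : ℝ) : ℝ :=
  (K + 1) * Real.exp (-K) * Real.exp (-((K + 1) * w)) *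
    besselI0 (2 * Real.sqrt (K * (K + 1) * w))

/-- The law of the fading power of a Rician channel with Rician factor `K` and unit mean. -/
def ricianPower (K : ℝ) : Measure ℝ :=
  (volume.restrict (Ici 0)).withDensity fun w => ENNReal.ofReal (ricianPowerPDF K w)

section PointProcess

variable {Ω E : Type*}

/-- For the random finite configuration `X 0, …, X (N - 1)`, the number of its points in `B`. -/
def pointCount (N : Ω → ℕ) (X : ℕ → Ω → E) (B : Set E) (ω : Ω) : ℕ :=
  Nat.card {j : ℕ // j < N ω ∧ X j ω ∈ B}

/-- The random finite configuration `X 0, …, X (N - 1)` (a random number `N` of random points; the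
values `X j` for `j ≥ N` are irrelevant) is a Poisson point process with finite intensity
measure `μ`: the number of points in every measurable set `B` is Poisson distributed with
mean `μ B`, and the numbers of points in pairwise disjoint measurable sets are independent. -/
structure IsPoissonPointProcess [MeasurableSpace Ω] [MeasurableSpace E] (P : Measure Ω)
    (N : Ω → ℕ) (X : ℕ → Ω → E) (μ : Measure E) [IsFiniteMeasure μ] : Prop where
  measurable_number : Measurable N
  measurable_point : ∀ j, Measurable (X j)
  count_law : ∀ B : Set E, MeasurableSet B →
    HasLaw (pointCount N X B) (poissonMeasure (μ B).toNNReal) P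
  count_indep : ∀ (m : ℕ) (B : Fin m → Set E), (∀ i, MeasurableSet (B i)) →
    Pairwise (fun i k => Disjoint (B i) (B k)) →
    iIndepFun (fun i => pointCount N X (B i)) P

end PointProcess

/-- The elevation angle of a transmitter at altitude `h` seen from a ground point at horizontal
distance `r` from its projection: `arctan (h / r)`, which is read as `π / 2` when `r = 0 < h`. -/
def elevationAngle (h r : ℝ) : ℝ :=
  if r = 0 ∧ 0 < h then Real.pi / 2 else Real.arctan (h / r)

/-- The parameters of the network. The ground is the Euclidean plane, identified with `ℂ`; its
origin is the projection of the UAV. -/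
structure RelayNetwork where
  /-- link constant (carrier frequency, antenna gain, …) -/
  A : ℝ
  /-- transmit power of the UAV -/
  PU : ℝ
  /-- transmit power of each relay -/
  PR : ℝ
  /-- noise power -/
  N0 : ℝ
  /-- SNR threshold -/
  ξ : ℝ
  /-- altitude of the UAV -/
  h : ℝ
  /-- radius of the disk in which the relays are located -/
  rC : ℝ
  /-- polar coordinates of the destination -/
  rD : ℝ
  φD : ℝ
  /-- density of the relays -/
  lam : ℝ
  /-- Rician factor as a function of the elevation angle -/
  K : ℝ → ℝ
  /-- path loss exponent as a function of the elevation angle -/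
  α : ℝ → ℝ
  A_pos : 0 < A
  PU_pos : 0 < PU
  PR_pos : 0 < PR
  N0_pos : 0 < N0
  ξ_pos : 0 < ξ
  h_nonneg : 0 ≤ h
  rC_nonneg : 0 ≤ rC
  rD_nonneg : 0 ≤ rD
  lam_nonneg : 0 ≤ lam
  K_nonneg : ∀ θ ∈ Icc 0 (Real.pi / 2), 0 ≤ K θ
  K_mono : MonotoneOn K (Icc 0 (Real.pi / 2))
  α_anti : AntitoneOn α (Icc 0 (Real.pi / 2))

namespace RelayNetwork

variable (S : RelayNetwork)

/-- `γ_U = A P_U / N₀` -/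
def γU : ℝ := S.A * S.PU / S.N0

/-- `γ_R = A P_R / N₀` -/
def γR : ℝ := S.A * S.PR / S.N0

/-- The location of the destination, with polar coordinates `(r_D, φ_D)`. -/
def dest : ℂ := (S.rD : ℂ) * Complex.exp ((S.φD : ℂ) * Complex.I)

/-- The elevation angle of the UAV at the ground point `x`. -/
def θR (x : ℂ) : ℝ := elevationAngle S.h ‖x‖

/-- The distance between the UAV and the ground point `x`. -/
def distUR (x : ℂ) : ℝ := Real.sqrt (‖x‖ ^ 2 + S.h ^ 2)

/-- The SNR at a relay located at `x` when the fading power of the UAV-relay link is `u`. -/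
def snrUR (x : ℂ) (u : ℝ) : ℝ :=
  S.A * S.PU / (S.N0 * S.distUR x ^ S.α (S.θR x)) * u

/-- The SNR at the destination when a relay located at `x` transmits and the fading power of the
relay-destination link is `v`; this is a ground-to-ground link, with path loss exponent `α 0`. -/
def snrRD (x : ℂ) (v : ℝ) : ℝ :=
  S.A * S.PR / (S.N0 * dist x S.dest ^ S.α 0) * v

/-- The intensity measure of the relays: `λ` times the area measure on the disk of radius `r_C`. -/
def intensity : Measure ℂ :=
  ENNReal.ofReal S.lam • volume.restrict (Metric.closedBall (0 : ℂ) S.rC)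

instance : IsFiniteMeasure S.intensity := by
  refine ⟨?_⟩
  simp only [intensity, Measure.smul_apply, Measure.restrict_apply_univ, smul_eq_mul]
  exact ENNReal.mul_lt_top ENNReal.ofReal_lt_top measure_closedBall_lt_top

variable {Ω : Type*}

/-- A realization of the relays and of the fading: the relays `X 0, …, X (N - 1)` form a Poisson
point process of density `λ` in the disk; `U j` and `V j` are the fading powers of the links
UAV-relay `j` and relay `j`-destination. Conditionally on the number and the locations of the
relays, all these fading powers are independent and Rician with unit mean, with Rician
factor `K(θ)` on the UAV-relay link, `θ` being the elevation angle at the relay, and `K(0)`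
on the relay-destination link. -/
structure IsRealization [MeasurableSpace Ω] (P : Measure Ω) (N : Ω → ℕ) (X : ℕ → Ω → ℂ)
    (U V : ℕ → Ω → ℝ) : Prop where
  relays : IsPoissonPointProcess P N X S.intensity
  measurable_U : ∀ j, Measurable (U j)
  measurable_V : ∀ j, Measurable (V j)
  fading : ∀ (n : ℕ) (E : Set (Fin n → ℂ)) (B C : Fin n → Set ℝ), MeasurableSet E →
    (∀ j, MeasurableSet (B j)) → (∀ j, MeasurableSet (C j)) →
    P {ω | N ω = n ∧ (fun j : Fin n => X j ω) ∈ E ∧ ∀ j : Fin n, U j ω ∈ B j ∧ V j ω ∈ C j} =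
      ∫⁻ ω in {ω | N ω = n ∧ (fun j : Fin n => X j ω) ∈ E},
        ∏ j : Fin n, (ricianPower (S.K (S.θR (X j ω))) (B j) * ricianPower (S.K 0) (C j)) ∂P

/-- The (indices of the) relays that decode the signal of the UAV. -/
def decodingSet (N : Ω → ℕ) (X : ℕ → Ω → ℂ) (U : ℕ → Ω → ℝ) (ω : Ω) : Set ℕ :=
  {j | j < N ω ∧ S.ξ < S.snrUR (X j ω) (U j ω)}

/-- `J` selects, whenever some relay decodes, a decoding relay with the highest SNR to the
destination. -/
def IsBestRelay (N : Ω → ℕ) (X : ℕ → Ω → ℂ) (U V : ℕ → Ω → ℝ) (J : Ω → ℕ) : Prop :=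
  ∀ ω, (S.decodingSet N X U ω).Nonempty → J ω ∈ S.decodingSet N X U ω ∧
    ∀ j ∈ S.decodingSet N X U ω, S.snrRD (X j ω) (V j ω) ≤ S.snrRD (X (J ω) ω) (V (J ω) ω)

open Classical in
/-- The SNR received at the destination from the selected relay `J`; it is zero when no relay
decodes, as nothing is retransmitted then. -/
def relayedSNR (N : Ω → ℕ) (X : ℕ → Ω → ℂ) (U V : ℕ → Ω → ℝ) (J : Ω → ℕ) (ω : Ω) : ℝ :=
  if (S.decodingSet N X U ω).Nonempty then S.snrRD (X (J ω) ω) (V (J ω) ω) else 0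

/-- `Q(√(2K(θ_R)), √(2[K(θ_R)+1] ξ ℓ_UR^α(θ_R) / γ_U))` with `θ_R = arctan (h / r)` and
`ℓ_UR = √(r² + h²)`. -/
def QUR (r : ℝ) : ℝ :=
  marcumQ (Real.sqrt (2 * S.K (Real.arctan (S.h / r))))
    (Real.sqrt (2 * (S.K (Real.arctan (S.h / r)) + 1) * S.ξ *
      Real.sqrt (r ^ 2 + S.h ^ 2) ^ S.α (Real.arctan (S.h / r)) / S.γU))

/-- `Q(√(2κ₀), √(2(κ₀+1) ξ ℓ_RD^α₀ / γ_R))` with `κ₀ = K 0`, `α₀ = α 0` and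
`ℓ_RD = √(r² + r_D² - 2 r r_D cos(φ - φ_D))`. -/
def QRD (r φ : ℝ) : ℝ :=
  marcumQ (Real.sqrt (2 * S.K 0))
    (Real.sqrt (2 * (S.K 0 + 1) * S.ξ *
      Real.sqrt (r ^ 2 + S.rD ^ 2 - 2 * r * S.rD * Real.cos (φ - S.φD)) ^ S.α 0 / S.γR))

def ψ1 : ℝ := 2 * Real.pi * ∫ r in (0 : ℝ)..S.rC, r * S.QUR r

def ψ2 : ℝ :=
  ∫ φ in (0 : ℝ)..(2 * Real.pi), ∫ r in (0 : ℝ)..S.rC, r * (1 - S.QRD r φ) * S.QUR r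

end RelayNetwork

end

/-! Outage occurs exactly when no relay both decodes and reaches the destination: the selected relay
maximises the second SNR among the decoding ones, and an empty decoding set gives SNR `0 ≤ ξ`
(`IsBestRelay.relayedSNR_le_iff`). Given the locations, the relays fail independently, a relay at
`x` with probability `1 - p x * q x`, where `p` and `q` are `decodeProb` and `forwardProb`. Hence
the outage probability is the mean of `∏ (1 - p q)` over the Poisson points, and the generating
functional (`IsPoissonPointProcess.integral_prod`) evaluates it as `exp (-∫ p q)`
(`IsRealization.outage_eq_exp`).

It remains to compute the integral. A quadratic substitution turns Rician tails into Marcum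
Q-functions (`ricianPower_real_Ioi`), so away from two points of the plane `p` and `q` are the
functions in the statement. In polar coordinates, writing `q = 1 - (1 - q)` splits the integral into
`ψ1 - ψ2`. -/

noncomputable section

/-! ### The Bessel series and the Rician fading law. -/

/-- The power series of `besselI0` converges absolutely. -/
lemma summable_besselI0 (x : ℝ) :
    Summable fun k : ℕ => (x / 2) ^ (2 * k) / (k.factorial : ℝ) ^ 2 := by
  refine Summable.of_nonneg_of_le (fun k => ?_) (fun k => ?_)
    (Real.summable_pow_div_factorial ((x / 2) ^ 2))
  · rw [pow_mul]; positivity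
  · rw [pow_mul]
    have h1 : (1 : ℝ) ≤ k.factorial := by exact_mod_cast Nat.succ_le_of_lt k.factorial_pos
    gcongr
    nlinarith

lemma besselI0_nonneg (x : ℝ) : 0 ≤ besselI0 x :=
  tsum_nonneg fun k => by rw [pow_mul]; positivity

@[fun_prop]
lemma measurable_besselI0 : Measurable besselI0 :=
  measurable_of_tendsto_metrizable
    (f := fun n (x : ℝ) => ∑ k ∈ Finset.range n, (x / 2) ^ (2 * k) / (k.factorial : ℝ) ^ 2)
    (fun n => by fun_prop)
    (tendsto_pi_nhds.2 fun x => (summable_besselI0 x).hasSum.tendsto_sum_nat)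

@[fun_prop]
lemma measurable_ricianPowerPDF : Measurable fun p : ℝ × ℝ => ricianPowerPDF p.1 p.2 := by
  unfold ricianPowerPDF
  fun_prop

lemma ricianPowerPDF_nonneg {K : ℝ} (hK : 0 ≤ K) (w : ℝ) : 0 ≤ ricianPowerPDF K w := by
  have := besselI0_nonneg (2 * Real.sqrt (K * (K + 1) * w))
  unfold ricianPowerPDF
  positivity

/-- The Rician power law is a Poisson mixture of Gamma laws. -/
lemma hasSum_ricianPowerPDF {K w : ℝ} (hK : 0 ≤ K) (hw : 0 ≤ w) :
    HasSum (fun k : ℕ => Real.exp (-K) * K ^ k / k.factorial * gammaPDFReal (k + 1) (K + 1) w)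
      (ricianPowerPDF K w) := by
  have h := (summable_besselI0 (2 * Real.sqrt (K * (K + 1) * w))).hasSum.mul_left
    ((K + 1) * Real.exp (-K) * Real.exp (-((K + 1) * w)))
  rw [← besselI0, ← ricianPowerPDF] at h
  refine h.congr_fun fun k => ?_
  have hK1 : 0 < K + 1 := by positivity
  have h1 : (k.factorial : ℝ) ≠ 0 := by positivity
  -- Only even powers of the square root occur in the Bessel series, so each term is a monomial in
  -- `w` times an exponential.
  rw [gammaPDFReal, if_pos hw, Real.Gamma_nat_eq_factorial, add_sub_cancel_right,
    Real.rpow_natCast, ← Nat.cast_add_one, Real.rpow_natCast, mul_div_cancel_left₀ _ two_ne_zero,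
    pow_mul, Real.sq_sqrt (by positivity), mul_pow, mul_pow, pow_succ]
  field_simp

/-- In the Gamma mixture each component has mass one and the weights are the Poisson probabilities
of mean `K`; Tonelli exchanges sum and integral. -/
lemma lintegral_ricianPowerPDF {K : ℝ} (hK : 0 ≤ K) :
    ∫⁻ w in Ici 0, ENNReal.ofReal (ricianPowerPDF K w) = 1 := by
  have hg : ∀ k : ℕ, ∀ w, 0 ≤ gammaPDFReal (k + 1) (K + 1) w := fun k w =>
    gammaPDFReal_nonneg (by positivity) (by positivity) w
  calc ∫⁻ w in Ici 0, ENNReal.ofReal (ricianPowerPDF K w)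
      = ∫⁻ w in Ici 0, ∑' k : ℕ, ENNReal.ofReal (Real.exp (-K) * K ^ k / k.factorial) *
          gammaPDF (k + 1) (K + 1) w := by
        refine setLIntegral_congr_fun measurableSet_Ici fun w hw => ?_
        have h := hasSum_ricianPowerPDF hK hw
        simp only [gammaPDF]
        rw [← h.tsum_eq, ENNReal.ofReal_tsum_of_nonneg _ h.summable]
        · refine tsum_congr fun k => ENNReal.ofReal_mul (by positivity)
        · intro k
          have := hg k w
          positivity
    _ = ∑' k : ℕ, ENNReal.ofReal (Real.exp (-K) * K ^ k / k.factorial) *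
          ∫⁻ w in Ici 0, gammaPDF (k + 1) (K + 1) w := by
        have hm : ∀ k : ℕ, Measurable (gammaPDF (k + 1) (K + 1)) := fun k =>
          (measurable_gammaPDFReal _ _).ennreal_ofReal
        rw [lintegral_tsum fun k => ((hm k).const_mul _).aemeasurable]
        exact tsum_congr fun k => lintegral_const_mul _ (hm k)
    _ = ∑' k : ℕ, ENNReal.ofReal (Real.exp (-K) * K ^ k / k.factorial) := by
        refine tsum_congr fun k => ?_
        have h1 : ∫⁻ w, gammaPDF (k + 1) (K + 1) w = 1 :=
          lintegral_gammaPDF_eq_one (by positivity) (by positivity)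
        have h2 : ∫⁻ w in Iio 0, gammaPDF (k + 1) (K + 1) w = 0 := lintegral_gammaPDF_of_nonpos le_rfl
        rw [← lintegral_add_compl _ (measurableSet_Ici (a := (0 : ℝ))), compl_Ici, h2, add_zero] at h1
        rw [h1, mul_one]
    _ = 1 := by
        have h : HasSum (fun k : ℕ => Real.exp (-K) * K ^ k / k.factorial) 1 :=
          hasSum_one_poissonMeasure ⟨K, hK⟩
        rw [← ENNReal.ofReal_tsum_of_nonneg (fun k => by positivity) h.summable]
        rw [h.tsum_eq, ENNReal.ofReal_one]

lemma isProbabilityMeasure_ricianPower {K : ℝ} (hK : 0 ≤ K) :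
    IsProbabilityMeasure (ricianPower K) :=
  ⟨by rw [ricianPower, withDensity_apply _ .univ, Measure.restrict_univ,
    lintegral_ricianPowerPDF hK]⟩

/-- The upper tail of the Rician power law is given by the Marcum Q-function. -/
lemma ricianPower_real_Ioi {K t : ℝ} (hK : 0 ≤ K) (ht : 0 ≤ t) :
    (ricianPower K).real (Ioi t) =
      marcumQ (Real.sqrt (2 * K)) (Real.sqrt (2 * (K + 1) * t)) := by
  set b := Real.sqrt (2 * (K + 1) * t) with hb
  have hb0 : 0 ≤ b := Real.sqrt_nonneg _
  have hK1 : 0 < 2 * (K + 1) := by positivity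
  -- The substitution `w = x² / (2(K+1))` makes the Bessel argument linear in `x`; its Jacobian `x /
  -- (K+1)` supplies the factor `x` of the Marcum integrand and cancels the `K + 1` of the density.
  have himg : (fun x : ℝ => x ^ 2 / (2 * (K + 1))) '' Ioi b = Ioi t := by
    ext w
    simp only [mem_image, mem_Ioi]
    constructor
    · rintro ⟨x, hx, rfl⟩
      rw [lt_div_iff₀ hK1]
      have := Real.lt_sq_of_sqrt_lt hx
      linarith
    · intro hw
      refine ⟨Real.sqrt (2 * (K + 1) * w), Real.sqrt_lt_sqrt (by positivity) (by gcongr), ?_⟩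
      rw [Real.sq_sqrt (by have := ht.trans hw.le; positivity)]
      field_simp
  have hinj : InjOn (fun x : ℝ => x ^ 2 / (2 * (K + 1))) (Ioi b) := by
    intro x hx y hy hxy
    have hx0 : 0 ≤ x := hb0.trans (le_of_lt hx)
    have hy0 : 0 ≤ y := hb0.trans (le_of_lt hy)
    have : x ^ 2 = y ^ 2 := by
      simpa [div_left_inj' hK1.ne'] using hxy
    exact (sq_eq_sq₀ hx0 hy0).1 this
  have hder : ∀ x ∈ Ioi b, HasDerivWithinAt (fun x : ℝ => x ^ 2 / (2 * (K + 1)))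
      (x / (K + 1)) (Ioi b) x := by
    intro x _
    refine (((hasDerivAt_id x).pow 2).div_const (2 * (K + 1))).hasDerivWithinAt.congr_deriv ?_
    simp
    field_simp
  rw [Measure.real, ricianPower, withDensity_apply _ measurableSet_Ioi,
    Measure.restrict_restrict measurableSet_Ioi,
    inter_eq_left.2 (Ioi_subset_Ici ht), ← integral_eq_lintegral_of_nonneg_ae
      (.of_forall fun w => ricianPowerPDF_nonneg hK w)
      (by unfold ricianPowerPDF; fun_prop), ← himg,
    integral_image_eq_integral_abs_deriv_smul measurableSet_Ioi hder hinj, marcumQ]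
  refine setIntegral_congr_fun measurableSet_Ioi fun x hx => ?_
  have hx0 : 0 < x := hb0.trans_lt hx
  have h1 : Real.sqrt (2 * K) * x = 2 * Real.sqrt (K * (K + 1) * (x ^ 2 / (2 * (K + 1)))) := by
    have : K * (K + 1) * (x ^ 2 / (2 * (K + 1))) = (2 * K) * (x / 2) ^ 2 := by field_simp
    rw [this, Real.sqrt_mul (x := 2 * K) (by positivity), Real.sqrt_sq (by positivity)]
    ring
  have h2 : Real.exp (-(x ^ 2 + Real.sqrt (2 * K) ^ 2) / 2) =
      Real.exp (-K) * Real.exp (-((K + 1) * (x ^ 2 / (2 * (K + 1))))) := by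
    rw [← Real.exp_add, Real.sq_sqrt (by positivity)]
    congr 1
    field_simp
    ring
  simp only [ricianPowerPDF, smul_eq_mul]
  rw [h1, h2, abs_of_pos (by positivity)]
  field_simp

/-! ### The probability generating functional of a Poisson process. -/

open scoped NNReal in
lemma integral_pow_poissonMeasure (r : ℝ≥0) (c : ℝ) :
    ∫ n, c ^ n ∂(poissonMeasure r) = Real.exp (-(r * (1 - c))) := by
  have h := (NormedSpace.expSeries_div_hasSum_exp ((r : ℝ) * c)).mul_left (Real.exp (-r))
  rw [← Real.exp_eq_exp_ℝ, ← Real.exp_add] at h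
  rw [integral_poissonMeasure, ← (show -(r : ℝ) + r * c = -(r * (1 - c)) by ring), ← h.tsum_eq]
  refine tsum_congr fun n => ?_
  rw [smul_eq_mul, mul_pow]
  ring

section PoissonPointProcess

variable {Ω E : Type*}

lemma pointCount_eq_card_filter (N : Ω → ℕ) (X : ℕ → Ω → E) (B : Set E) (ω : Ω)
    [DecidablePred fun j => X j ω ∈ B] :
    pointCount N X B ω = ((Finset.range (N ω)).filter fun j => X j ω ∈ B).card := by
  rw [pointCount, ← Nat.card_eq_finsetCard]
  exact Nat.card_congr (Equiv.subtypeEquivRight fun j => by simp)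

variable [MeasurableSpace Ω] [MeasurableSpace E]

/-- The number of factors is random but takes countably many values, so it can be frozen. -/
lemma measurable_prod_points {N : Ω → ℕ} {X : ℕ → Ω → E} (hN : Measurable N)
    (hX : ∀ j, Measurable (X j)) {f : E → ℝ} (hf : Measurable f) :
    Measurable fun ω => ∏ j ∈ Finset.range (N ω), f (X j ω) := by
  have : Measurable fun p : ℕ × Ω => ∏ j ∈ Finset.range p.1, f (X j p.2) :=
    measurable_from_prod_countable_right fun n =>
      Finset.measurable_fun_prod (Finset.range n) fun j _ => hf.comp (hX j)
  exact this.comp (hN.prodMk measurable_id)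

variable {P : Measure Ω} {N : Ω → ℕ} {X : ℕ → Ω → E} {μ : Measure E} [IsFiniteMeasure μ]

/-- Grouping the points by the value of `f` turns the product into one of powers `c ^ count`, the
counts being taken over the disjoint fibres of `f`. They are independent and Poisson, so the mean
factors into one-variable generating functions whose exponents add up to the integral. -/
lemma IsPoissonPointProcess.integral_prod_simpleFunc (h : IsPoissonPointProcess P N X μ)
    (f : SimpleFunc E ℝ) :
    ∫ ω, ∏ j ∈ Finset.range (N ω), f (X j ω) ∂P = Real.exp (-∫ x, (1 - f x) ∂μ) := by
  classical
  let e : Fin f.range.card ≃ f.range := f.range.equivFin.symm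
  have hB : ∀ i, MeasurableSet (f ⁻¹' {(e i : ℝ)}) := fun i => f.measurableSet_fiber _
  have hprod : ∀ ω, ∏ j ∈ Finset.range (N ω), f (X j ω) =
      ∏ i, (e i : ℝ) ^ pointCount N X (f ⁻¹' {(e i : ℝ)}) ω := fun ω => by
    rw [← Finset.prod_fiberwise_of_maps_to' (t := f.range) (g := fun j => f (X j ω))
      (fun j _ => f.mem_range_self _) (fun c => c), ← Finset.prod_coe_sort, ← e.prod_comp]
    refine Finset.prod_congr rfl fun i _ => ?_
    rw [Finset.prod_const, pointCount_eq_card_filter]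
    rfl
  have hsum : ∀ x, 1 - f x = ∑ i, (f ⁻¹' {(e i : ℝ)}).indicator (fun _ => 1 - (e i : ℝ)) x :=
    fun x => by
    rw [e.sum_comp (fun c : f.range => (f ⁻¹' {(c : ℝ)}).indicator (fun _ => 1 - (c : ℝ)) x),
      Finset.sum_eq_single ⟨f x, f.mem_range_self x⟩]
    · simp
    · intro c _ hc
      refine indicator_of_notMem (fun hx => hc ?_) _
      exact Subtype.ext (Eq.symm hx)
    · simp
  simp_rw [hprod, hsum]
  rw [(h.count_indep _ (fun i => f ⁻¹' {(e i : ℝ)}) hB ?_).integral_fun_prod_comp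
      (f := fun i n => (e i : ℝ) ^ n) (fun i => (h.count_law _ (hB i)).aemeasurable)
      (fun i => Measurable.of_discrete.aestronglyMeasurable),
    integral_finsetSum _ fun i _ => (integrable_const _).indicator (hB i), ← Finset.sum_neg_distrib,
    Real.exp_sum]
  · refine Finset.prod_congr rfl fun i _ => ?_
    rw [integral_indicator_const _ (hB i), smul_eq_mul]
    exact ((h.count_law _ (hB i)).integral_comp (f := fun n => (e i : ℝ) ^ n)
      Measurable.of_discrete.aestronglyMeasurable).trans (integral_pow_poissonMeasure _ _)
  · intro i k hik
    refine Disjoint.preimage _ (disjoint_singleton.2 fun hc => hik ?_)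
    exact e.injective (Subtype.ext hc)

/-- The probability generating functional of a Poisson point process. -/
theorem IsPoissonPointProcess.integral_prod [IsProbabilityMeasure P]
    (h : IsPoissonPointProcess P N X μ)
    {f : E → ℝ} (hf : Measurable f) (hf01 : ∀ x, f x ∈ Icc (0 : ℝ) 1) :
    ∫ ω, ∏ j ∈ Finset.range (N ω), f (X j ω) ∂P = Real.exp (-∫ x, (1 - f x) ∂μ) := by
  have h0 : (0 : ℝ) ∈ Icc (0 : ℝ) 1 := by simp
  -- Approximants with values in `[0, 1]` keep both the products and `1 - g n` in `[0, 1]`, so the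
  -- constant `1` dominates on both sides of the identity.
  let g : ℕ → SimpleFunc E ℝ := SimpleFunc.approxOn f hf (Icc 0 1) 0 h0
  have hg : ∀ n x, g n x ∈ Icc (0 : ℝ) 1 := SimpleFunc.approxOn_mem hf h0
  have hlim : ∀ x, Filter.Tendsto (fun n => g n x) Filter.atTop (nhds (f x)) := fun x =>
    SimpleFunc.tendsto_approxOn hf h0 (subset_closure (hf01 x))
  refine tendsto_nhds_unique (f := fun n => ∫ ω, ∏ j ∈ Finset.range (N ω), g n (X j ω) ∂P)
    (l := Filter.atTop) ?_ ?_
  · refine tendsto_integral_of_dominated_convergence (fun _ => 1)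
      (fun n => (measurable_prod_points h.measurable_number h.measurable_point
        (g n).measurable).aestronglyMeasurable) (integrable_const _) (fun n => .of_forall fun ω => ?_)
      (.of_forall fun ω => tendsto_finsetProd _ fun j _ => hlim _)
    rw [Real.norm_of_nonneg (Finset.prod_nonneg fun j _ => (hg n _).1)]
    exact Finset.prod_le_one (fun j _ => (hg n _).1) fun j _ => (hg n _).2
  · simp_rw [h.integral_prod_simpleFunc]
    refine (Real.continuous_exp.tendsto _).comp (Filter.Tendsto.neg ?_)
    refine tendsto_integral_of_dominated_convergence (fun _ => 1)
      (fun n => (measurable_const.sub (g n).measurable).aestronglyMeasurable)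
      (integrable_const _) (fun n => .of_forall fun x => ?_)
      (.of_forall fun x => (hlim x).const_sub 1)
    rw [Real.norm_of_nonneg (sub_nonneg.2 (hg n x).2)]
    linarith [(hg n x).1]

end PoissonPointProcess

/-! ### Independent marks attached to random points. -/

section Marks

variable {Ω ι E α β G : Type*} [Fintype ι] [MeasurableSpace Ω] [MeasurableSpace E]
  [MeasurableSpace α] [MeasurableSpace β] [MeasurableSpace G]

/-- The kernel that attaches independent marks, distributed according to the Markov kernel `κ`,
to the members of a finite family of points. -/
def piMarkKernel (ι : Type*) [Fintype ι] (κ : Kernel E G) [IsMarkovKernel κ] :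
    Kernel (ι → E) (ι → G) where
  toFun x := Measure.pi fun j => κ (x j)
  measurable' := by
    refine .measure_of_isPiSystem_of_isProbabilityMeasure generateFrom_pi.symm isPiSystem_pi ?_
    rintro _ ⟨s, hs, rfl⟩
    simp only [Measure.pi_pi]
    exact Finset.measurable_fun_prod _ fun j _ =>
      (κ.measurable_coe (hs j (mem_univ j))).comp (measurable_pi_apply j)

lemma piMarkKernel_apply (κ : Kernel E G) [IsMarkovKernel κ] (x : ι → E) :
    piMarkKernel ι κ x = Measure.pi fun j => κ (x j) := rfl

instance (κ : Kernel E G) [IsMarkovKernel κ] : IsMarkovKernel (piMarkKernel ι κ) :=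
  ⟨fun x => by rw [piMarkKernel_apply]; infer_instance⟩

/-- If the conditional probability that pairs of marks lie in given rectangles is that of
independent marks with laws `κ` and `η`, then so is the joint law of all marks. -/
lemma measure_marks_eq_lintegral {P : Measure Ω} [IsFiniteMeasure P] {X : Ω → ι → E}
    {Y : Ω → ι → α × β} (hX : Measurable X) (hY : Measurable Y)
    (κ : Kernel E α) (η : Kernel E β) [IsMarkovKernel κ] [IsMarkovKernel η]
    (h : ∀ (B : ι → Set α) (C : ι → Set β), (∀ j, MeasurableSet (B j)) →
      (∀ j, MeasurableSet (C j)) → P {ω | ∀ j, Y ω j ∈ B j ×ˢ C j} =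
        ∫⁻ ω, ∏ j, (κ (X ω j) (B j) * η (X ω j) (C j)) ∂P)
    {t : Set (ι → α × β)} (ht : MeasurableSet t) :
    P (Y ⁻¹' t) = ∫⁻ ω, piMarkKernel ι (κ ×ₖ η) (X ω) t ∂P := by
  -- The candidate law is the mixture of product measures over the locations. Both laws are finite
  -- with the same total mass, so agreement on boxes of rectangles, a generating π-system, is
  -- enough.
  let ν : Measure (ι → α × β) := ((piMarkKernel ι (κ ×ₖ η)).comap X hX) ∘ₘ P
  have hν : ∀ t, MeasurableSet t → ν t = ∫⁻ ω, piMarkKernel ι (κ ×ₖ η) (X ω) t ∂P := fun t ht =>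
    Measure.bind_apply ht (Kernel.aemeasurable _)
  suffices P.map Y = ν by rw [← hν t ht, ← this, Measure.map_apply hY ht]
  refine ext_of_generate_finite _ (generateFrom_eq_pi (fun _ : ι => generateFrom_prod)
    fun _ => isCountablySpanning_measurableSet.prod isCountablySpanning_measurableSet).symm
    (IsPiSystem.pi fun _ => isPiSystem_prod) ?_ ?_
  · rintro _ ⟨s, hs, rfl⟩
    choose B hB C hC hBC using fun j => hs j (mem_univ j)
    have hm : MeasurableSet (univ.pi s) := by
      refine MeasurableSet.univ_pi fun j => ?_
      rw [← hBC j]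
      exact (hB j).prod (hC j)
    rw [Measure.map_apply hY hm, hν _ hm]
    simp only [piMarkKernel_apply, Measure.pi_pi, ← hBC, Kernel.prod_apply_prod]
    rw [← h B C hB hC]
    congr 1
    ext ω
    simp [← hBC]
  · rw [Measure.map_apply hY .univ, hν _ .univ]
    simp

/-- Joint law of points and conditionally independent marks, evaluated at the event that every
marked point lies in `D`. -/
lemma measure_forall_mem_eq_lintegral {P : Measure Ω} [IsFiniteMeasure P] {X : Ω → ι → E}
    {Y : Ω → ι → α × β} (hX : Measurable X) (hY : Measurable Y)
    (κ : Kernel E α) (η : Kernel E β) [IsMarkovKernel κ] [IsMarkovKernel η]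
    (h : ∀ (S : Set (ι → E)) (B : ι → Set α) (C : ι → Set β), MeasurableSet S →
      (∀ j, MeasurableSet (B j)) → (∀ j, MeasurableSet (C j)) →
      P {ω | X ω ∈ S ∧ ∀ j, Y ω j ∈ B j ×ˢ C j} =
        ∫⁻ ω in X ⁻¹' S, ∏ j, (κ (X ω j) (B j) * η (X ω j) (C j)) ∂P)
    {D : Set (E × α × β)} (hD : MeasurableSet D) :
    P {ω | ∀ j, (X ω j, Y ω j) ∈ D} =
      ∫⁻ ω, ∏ j, (κ ×ₖ η) (X ω j) (Prod.mk (X ω j) ⁻¹' D) ∂P := by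
  -- `D` may couple location and marks, so the full joint law is needed. For a fixed location set
  -- `s`, the law of the marks is found by applying the preceding lemma to `P` restricted to `X ⁻¹'
  -- s`.
  have hlaw : P.map (fun ω => (X ω, Y ω)) = (P.map X) ⊗ₘ piMarkKernel ι (κ ×ₖ η) := by
    refine Measure.ext_prod fun {s t} hs ht => ?_
    rw [Measure.map_apply (hX.prodMk hY) (hs.prod ht), Measure.compProd_apply_prod hs ht,
      setLIntegral_map hs (Kernel.measurable_coe _ ht) hX,
      ← measure_marks_eq_lintegral hX hY κ η (fun B C hB hC => ?_) ht,
      Measure.restrict_apply (hY ht), inter_comm]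
    · rfl
    · rw [← h s B C hs hB hC, Measure.restrict_apply]
      · rw [inter_comm]; rfl
      · rw [ofPred_forall]
        exact MeasurableSet.iInter fun j =>
          ((measurable_pi_apply j).comp hY) ((hB j).prod (hC j))
  have hH : MeasurableSet {p : (ι → E) × (ι → α × β) | ∀ j, (p.1 j, p.2 j) ∈ D} := by
    rw [ofPred_forall]
    refine MeasurableSet.iInter fun j => ?_
    exact (show Measurable fun p : (ι → E) × (ι → α × β) => (p.1 j, p.2 j) by fun_prop) hD
  calc P {ω | ∀ j, (X ω j, Y ω j) ∈ D}
      = P.map (fun ω => (X ω, Y ω)) {p | ∀ j, (p.1 j, p.2 j) ∈ D} :=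
        (Measure.map_apply (hX.prodMk hY) hH).symm
    -- Once the locations are fixed the event is a box, so its product measure factors over `j`.
    _ = ∫⁻ ω, piMarkKernel ι (κ ×ₖ η) (X ω) (univ.pi fun j => Prod.mk (X ω j) ⁻¹' D) ∂P := by
        rw [hlaw, Measure.compProd_apply hH,
          lintegral_map (Kernel.measurable_kernel_prodMk_left hH) hX]
        refine lintegral_congr fun ω => ?_
        congr 1
        ext y
        simp
    _ = _ := by simp only [piMarkKernel_apply, Measure.pi_pi]

end Marks

/-! ### The elevation angle and measurability of monotone functions of it. -/

lemma elevationAngle_mem_Icc {h r : ℝ} (hh : 0 ≤ h) (hr : 0 ≤ r) :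
    elevationAngle h r ∈ Icc 0 (Real.pi / 2) := by
  unfold elevationAngle
  split_ifs
  · exact ⟨by positivity, le_rfl⟩
  · exact ⟨Real.arctan_nonneg.2 (by positivity), (Real.arctan_lt_pi_div_two _).le⟩

lemma elevationAngle_of_ne_zero {h r : ℝ} (hr : r ≠ 0) :
    elevationAngle h r = Real.arctan (h / r) := by
  simp [elevationAngle, hr]

lemma measurable_elevationAngle (h : ℝ) : Measurable (elevationAngle h) := by
  unfold elevationAngle
  refine Measurable.ite ?_ measurable_const (by fun_prop)
  exact (measurableSet_singleton 0).inter (MeasurableSet.const _)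

/-- Nothing is known about `f` off the interval; composing with the projection onto it gives a
globally monotone, hence Borel, function with the same values along `g`. This serves `K` and `-α`.
-/
lemma MonotoneOn.measurable_comp_of_mem_Icc {Ω : Type*} [MeasurableSpace Ω] {f : ℝ → ℝ} {a b : ℝ}
    (hf : MonotoneOn f (Icc a b)) {g : Ω → ℝ} (hg : Measurable g) (hab : ∀ x, g x ∈ Icc a b) :
    Measurable fun x => f (g x) := by
  rcases isEmpty_or_nonempty Ω with _ | ⟨⟨x₀⟩⟩
  · exact measurable_of_empty _
  have h : a ≤ b := (hab x₀).1.trans (hab x₀).2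
  have hm : Monotone fun t => f (projIcc a b h t) := fun s t hst =>
    hf (projIcc a b h s).2 (projIcc a b h t).2 (monotone_projIcc h hst)
  have hfg : (fun x => f (g x)) = fun x => f (projIcc a b h (g x)) :=
    funext fun x => by rw [projIcc_of_mem h (hab x)]
  rw [hfg]
  exact hm.measurable.comp hg

/-! ### Link probabilities and the outage as a void probability. -/

namespace RelayNetwork

variable (S : RelayNetwork)

lemma γR_pos : 0 < S.γR := div_pos (mul_pos S.A_pos S.PR_pos) S.N0_pos

lemma θR_mem (x : ℂ) : S.θR x ∈ Icc 0 (Real.pi / 2) :=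
  elevationAngle_mem_Icc S.h_nonneg (norm_nonneg x)

lemma K_zero_nonneg : 0 ≤ S.K 0 := S.K_nonneg 0 ⟨le_rfl, by positivity⟩

lemma K_θR_nonneg (x : ℂ) : 0 ≤ S.K (S.θR x) := S.K_nonneg _ (S.θR_mem x)

@[fun_prop]
lemma measurable_θR : Measurable S.θR := (measurable_elevationAngle S.h).comp measurable_norm

@[fun_prop]
lemma measurable_K_θR : Measurable fun x => S.K (S.θR x) :=
  S.K_mono.measurable_comp_of_mem_Icc S.measurable_θR S.θR_mem

@[fun_prop]
lemma measurable_α_θR : Measurable fun x => S.α (S.θR x) := by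
  have h : MonotoneOn (fun t => -S.α t) (Icc 0 (Real.pi / 2)) := S.α_anti.neg
  simpa only [Pi.neg_def, neg_neg] using
    (h.measurable_comp_of_mem_Icc S.measurable_θR S.θR_mem).neg

lemma measurable_snrUR : Measurable fun p : ℂ × ℝ => S.snrUR p.1 p.2 := by
  unfold snrUR distUR
  have h := S.measurable_α_θR
  have h' : Measurable fun p : ℂ × ℝ => S.α (S.θR p.1) := h.comp measurable_fst
  fun_prop

lemma measurable_snrRD : Measurable fun p : ℂ × ℝ => S.snrRD p.1 p.2 := by
  unfold snrRD
  fun_prop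

@[fun_prop]
lemma _root_.Measurable.snrUR {β : Type*} [MeasurableSpace β] {f : β → ℂ} {g : β → ℝ}
    (hf : Measurable f) (hg : Measurable g) : Measurable fun b => S.snrUR (f b) (g b) := by
  have h := S.measurable_snrUR.comp (hf.prodMk hg)
  exact h

@[fun_prop]
lemma _root_.Measurable.snrRD {β : Type*} [MeasurableSpace β] {f : β → ℂ} {g : β → ℝ}
    (hf : Measurable f) (hg : Measurable g) : Measurable fun b => S.snrRD (f b) (g b) := by
  have h := S.measurable_snrRD.comp (hf.prodMk hg)
  exact h

/-- The law of the fading power of the UAV-relay link as a function of the relay location. -/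
def urKernel : Kernel ℂ ℝ where
  toFun x := ricianPower (S.K (S.θR x))
  measurable' := by
    refine Measure.measurable_of_measurable_coe _ fun s hs => ?_
    simp only [ricianPower, withDensity_apply _ hs]
    refine Measurable.lintegral_prod_right'
      (f := fun p : ℂ × ℝ => ENNReal.ofReal (ricianPowerPDF (S.K (S.θR p.1)) p.2)) ?_
    exact (measurable_ricianPowerPDF.comp
      ((S.measurable_K_θR.comp measurable_fst).prodMk measurable_snd)).ennreal_ofReal

lemma urKernel_apply (x : ℂ) : S.urKernel x = ricianPower (S.K (S.θR x)) := rfl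

instance : IsMarkovKernel S.urKernel :=
  ⟨fun x => isProbabilityMeasure_ricianPower (S.K_θR_nonneg x)⟩

/-- The law of the fading power of the relay-destination link. -/
def rdKernel : Kernel ℂ ℝ := Kernel.const ℂ (ricianPower (S.K 0))

lemma rdKernel_apply (x : ℂ) : S.rdKernel x = ricianPower (S.K 0) := Kernel.const_apply _ _

instance : IsMarkovKernel S.rdKernel :=
  ⟨fun x => by
    rw [rdKernel_apply]
    exact isProbabilityMeasure_ricianPower S.K_zero_nonneg⟩

/-- The probability that a relay at `x` decodes. -/
def decodeProb (x : ℂ) : ℝ := (S.urKernel x).real {u | S.ξ < S.snrUR x u}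

/-- The probability that the link from a relay at `x` to the destination is not in outage. -/
def forwardProb (x : ℂ) : ℝ := (S.rdKernel x).real {v | S.ξ < S.snrRD x v}

@[fun_prop]
lemma measurable_decodeProb : Measurable S.decodeProb :=
  (Kernel.measurable_kernel_prodMk_left (κ := S.urKernel)
    (measurableSet_lt measurable_const S.measurable_snrUR)).ennreal_toReal

@[fun_prop]
lemma measurable_forwardProb : Measurable S.forwardProb :=
  (Kernel.measurable_kernel_prodMk_left (κ := S.rdKernel)
    (measurableSet_lt measurable_const S.measurable_snrRD)).ennreal_toReal

lemma decodeProb_mem (x : ℂ) : S.decodeProb x ∈ Icc (0 : ℝ) 1 :=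
  ⟨measureReal_nonneg, measureReal_le_one⟩

lemma forwardProb_mem (x : ℂ) : S.forwardProb x ∈ Icc (0 : ℝ) 1 :=
  ⟨measureReal_nonneg, measureReal_le_one⟩

/-- The marked points (location, fading powers) that cannot serve the destination. -/
def useless : Set (ℂ × ℝ × ℝ) :=
  {p | ¬ (S.ξ < S.snrUR p.1 p.2.1 ∧ S.ξ < S.snrRD p.1 p.2.2)}

lemma measurableSet_useless : MeasurableSet S.useless := by
  have hU : Measurable fun p : ℂ × ℝ × ℝ => S.snrUR p.1 p.2.1 := by fun_prop
  have hV : Measurable fun p : ℂ × ℝ × ℝ => S.snrRD p.1 p.2.2 := by fun_prop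
  exact ((measurableSet_lt measurable_const hU).inter (measurableSet_lt measurable_const hV)).compl

/-- At a fixed location the two links fade independently, so the success probabilities multiply. -/
lemma prod_kernel_useless (x : ℂ) :
    (S.urKernel ×ₖ S.rdKernel) x (Prod.mk x ⁻¹' S.useless) =
      ENNReal.ofReal (1 - S.decodeProb x * S.forwardProb x) := by
  have hU : MeasurableSet {u | S.ξ < S.snrUR x u} :=
    measurableSet_lt measurable_const (by fun_prop)
  have hV : MeasurableSet {v | S.ξ < S.snrRD x v} :=
    measurableSet_lt measurable_const (by fun_prop)
  have : Prod.mk x ⁻¹' S.useless = ({u | S.ξ < S.snrUR x u} ×ˢ {v | S.ξ < S.snrRD x v})ᶜ := rfl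
  rw [this, ← ofReal_measureReal, probReal_compl_eq_one_sub (hU.prod hV), measureReal_def,
    Kernel.prod_apply_prod, ENNReal.toReal_mul]
  rfl

variable {S} {Ω : Type*} {N : Ω → ℕ} {X : ℕ → Ω → ℂ} {U V : ℕ → Ω → ℝ} {J : Ω → ℕ}

/-- The relayed signal is in outage iff no relay both decodes and reaches the destination. -/
lemma IsBestRelay.relayedSNR_le_iff (hJ : S.IsBestRelay N X U V J) (ω : Ω) :
    S.relayedSNR N X U V J ω ≤ S.ξ ↔ ∀ j < N ω, (X j ω, U j ω, V j ω) ∈ S.useless := by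
  unfold relayedSNR
  split_ifs with h
  · obtain ⟨hmem, hbest⟩ := hJ ω h
    constructor
    · rintro hle j hj ⟨hU, hV⟩
      exact absurd (hV.trans_le ((hbest j ⟨hj, hU⟩).trans hle)) (lt_irrefl _)
    · intro hall
      by_contra hlt
      exact hall _ hmem.1 ⟨hmem.2, not_le.1 hlt⟩
  · refine iff_of_true S.ξ_pos.le fun j hj hgood => h ⟨j, hj, hgood.1⟩

variable [MeasurableSpace Ω] {P : Measure Ω} [IsProbabilityMeasure P]

/-- On `N = n` there are `n` marked points, so the marking lemma applies to `P` restricted to that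
event, a finite measure but not in general a probability. -/
lemma IsRealization.measure_useless_inter (hreal : S.IsRealization P N X U V) (n : ℕ) :
    P ({ω | ∀ j : Fin n, (X j ω, U j ω, V j ω) ∈ S.useless} ∩ N ⁻¹' {n}) =
      ∫⁻ ω in N ⁻¹' {n}, ENNReal.ofReal
        (∏ j ∈ Finset.range n, (1 - S.decodeProb (X j ω) * S.forwardProb (X j ω))) ∂P := by
  have hn : MeasurableSet (N ⁻¹' {n}) := hreal.relays.measurable_number (measurableSet_singleton n)
  have hX : Measurable fun ω (j : Fin n) => X j ω :=
    measurable_pi_lambda _ fun j => hreal.relays.measurable_point j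
  have hY : Measurable fun ω (j : Fin n) => (U j ω, V j ω) :=
    measurable_pi_lambda _ fun j => (hreal.measurable_U j).prodMk (hreal.measurable_V j)
  have key := measure_forall_mem_eq_lintegral (P := P.restrict (N ⁻¹' {n})) hX hY S.urKernel
    S.rdKernel (fun E B C hE hB hC => ?_) S.measurableSet_useless
  · rw [Measure.restrict_apply' hn] at key
    rw [key]
    refine lintegral_congr fun ω => ?_
    rw [← Fin.prod_univ_eq_prod_range
      (fun j => 1 - S.decodeProb (X j ω) * S.forwardProb (X j ω)), ENNReal.ofReal_prod_of_nonneg]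
    · simp only [prod_kernel_useless]
    · intro j _
      exact sub_nonneg.2 (mul_le_one₀ (S.decodeProb_mem _).2 (S.forwardProb_mem _).1
        (S.forwardProb_mem _).2)
  · have h := hreal.fading n E B C hE hB hC
    rw [Measure.restrict_apply' hn, Measure.restrict_restrict (hX hE)]
    simp only [urKernel_apply, rdKernel_apply]
    have h1 : {ω | N ω = n ∧ (fun j : Fin n => X j ω) ∈ E} =
        (fun ω (j : Fin n) => X j ω) ⁻¹' E ∩ N ⁻¹' {n} := by
      ext ω
      exact and_comm
    rw [← h1, ← h]
    congr 1
    ext ω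
    simp only [mem_inter_iff, mem_ofPred_eq, mem_prod, mem_preimage, mem_singleton_iff]
    tauto

/-- The relaying outage probability as a void probability. -/
theorem IsRealization.outage_eq_exp (hreal : S.IsRealization P N X U V)
    (hJ : S.IsBestRelay N X U V J) :
    P.real {ω | S.relayedSNR N X U V J ω ≤ S.ξ} =
      Real.exp (-∫ x, S.decodeProb x * S.forwardProb x ∂S.intensity) := by
  have hN := hreal.relays.measurable_number
  have hf : Measurable fun x => 1 - S.decodeProb x * S.forwardProb x := by fun_prop
  have hf01 : ∀ x, 1 - S.decodeProb x * S.forwardProb x ∈ Icc (0 : ℝ) 1 := fun x =>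
    ⟨sub_nonneg.2 (mul_le_one₀ (S.decodeProb_mem _).2 (S.forwardProb_mem _).1
        (S.forwardProb_mem _).2),
      sub_le_self _ (mul_nonneg (S.decodeProb_mem _).1 (S.forwardProb_mem _).1)⟩
  -- This description does not involve `J`, so the event is measurable whichever maximiser is
  -- selected.
  have hsets : {ω | S.relayedSNR N X U V J ω ≤ S.ξ} =
      ⋃ n, {ω | ∀ j : Fin n, (X j ω, U j ω, V j ω) ∈ S.useless} ∩ N ⁻¹' {n} := by
    ext ω
    simp [hJ.relayedSNR_le_iff, Fin.forall_iff]
  have hdisj : Pairwise (Function.onFun Disjoint fun n => N ⁻¹' {n}) := fun m n hmn =>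
    Disjoint.preimage _ (disjoint_singleton.2 hmn)
  have hmeas : ∀ n, MeasurableSet (N ⁻¹' {n}) := fun n => hN (measurableSet_singleton n)
  have hpgfl := hreal.relays.integral_prod hf hf01
  simp only [sub_sub_cancel] at hpgfl
  rw [← hpgfl, integral_eq_lintegral_of_nonneg_ae
    (.of_forall fun ω => Finset.prod_nonneg fun j _ => (hf01 _).1)
    (measurable_prod_points hN hreal.relays.measurable_point hf).aestronglyMeasurable,
    measureReal_def, hsets, measure_iUnion]
  · congr 1
    rw [← setLIntegral_univ, ← preimage_univ (f := N), ← iUnion_of_singleton ℕ, preimage_iUnion,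
      lintegral_iUnion hmeas hdisj]
    refine tsum_congr fun n => ?_
    rw [hreal.measure_useless_inter n]
    refine setLIntegral_congr_fun (hmeas n) fun ω hω => ?_
    rw [mem_preimage, mem_singleton_iff] at hω
    rw [hω]
  · exact fun m n hmn => (hdisj hmn).mono inter_subset_right inter_subset_right
  · intro n
    rw [ofPred_forall]
    refine (MeasurableSet.iInter fun j => ?_).inter (hmeas n)
    exact ((hreal.relays.measurable_point j).prodMk
      ((hreal.measurable_U j).prodMk (hreal.measurable_V j))) S.measurableSet_useless

end RelayNetwork

/-! ### Marcum Q-functions and the integral in polar coordinates. -/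

lemma ricianPower_real_Ioi_mem {K : ℝ} (hK : 0 ≤ K) (t : ℝ) :
    (ricianPower K).real (Ioi t) ∈ Icc (0 : ℝ) 1 := by
  have := isProbabilityMeasure_ricianPower hK
  exact ⟨measureReal_nonneg, measureReal_le_one⟩

lemma measurable_ricianPower_real_Ioi {K : ℝ} (hK : 0 ≤ K) :
    Measurable fun t => (ricianPower K).real (Ioi t) := by
  have := isProbabilityMeasure_ricianPower hK
  exact Antitone.measurable fun s t hst => measureReal_mono (Ioi_subset_Ioi hst)

/-- The probability that the SNR of a Rician link with path loss `L` exceeds the threshold. -/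
lemma ricianPower_real_snr {K A p n ξ L : ℝ} (hK : 0 ≤ K) (hA : 0 < A) (hp : 0 < p) (hn : 0 < n)
    (hξ : 0 < ξ) (hL : 0 < L) :
    (ricianPower K).real {u | ξ < A * p / (n * L) * u} =
      marcumQ (Real.sqrt (2 * K)) (Real.sqrt (2 * (K + 1) * ξ * L / (A * p / n))) := by
  have hset : {u | ξ < A * p / (n * L) * u} = Ioi (ξ * L / (A * p / n)) := by
    ext u
    rw [mem_ofPred_eq, mem_Ioi, div_lt_iff₀ (by positivity), div_mul_eq_mul_div,
      lt_div_iff₀ (by positivity), mul_div_assoc', lt_div_iff₀ hn]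
    constructor <;> intro h <;> linarith
  rw [hset, ricianPower_real_Ioi hK (by positivity)]
  congr 2
  ring

namespace RelayNetwork

variable (S : RelayNetwork)

/-- The origin is excluded: for `0 < h` the angle there is `π / 2`, whereas `QUR 0` reads `h / 0` as
`0`; for `h = 0` the distance vanishes. -/
lemma decodeProb_eq {x : ℂ} (hx : x ≠ 0) : S.decodeProb x = S.QUR ‖x‖ := by
  have hx' : 0 < ‖x‖ := norm_pos_iff.2 hx
  have hθ : S.θR x = Real.arctan (S.h / ‖x‖) := elevationAngle_of_ne_zero hx'.ne'
  rw [decodeProb, urKernel_apply]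
  simp only [snrUR]
  have hd : 0 < S.distUR x := Real.sqrt_pos.2 (by positivity)
  rw [ricianPower_real_snr (S.K_θR_nonneg x) S.A_pos S.PU_pos S.N0_pos S.ξ_pos
    (Real.rpow_pos_of_pos hd _), hθ]
  rfl

/-- The probability that a relay at `x` can reach the destination, in terms of the Marcum
Q-function. -/
def forwardQ (x : ℂ) : ℝ :=
  marcumQ (Real.sqrt (2 * S.K 0))
    (Real.sqrt (2 * (S.K 0 + 1) * S.ξ * dist x S.dest ^ S.α 0 / S.γR))

/-- At the destination itself, if `α 0 ≠ 0`, division by zero makes the SNR `0` while the Marcum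
expression is a tail from `0`. -/
lemma forwardProb_eq {x : ℂ} (hx : x ≠ S.dest) : S.forwardProb x = S.forwardQ x := by
  rw [forwardProb, rdKernel_apply]
  exact ricianPower_real_snr S.K_zero_nonneg S.A_pos S.PR_pos S.N0_pos S.ξ_pos
    (Real.rpow_pos_of_pos (dist_pos.2 hx) _)

/-- Valid at every point, the destination included; measurability and the bounds of `forwardQ`
follow from those of a tail probability, with no study of `marcumQ`. -/
lemma forwardQ_eq (x : ℂ) :
    S.forwardQ x = (ricianPower (S.K 0)).real (Ioi (S.ξ * dist x S.dest ^ S.α 0 / S.γR)) := by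
  have := S.γR_pos
  have := S.ξ_pos
  rw [ricianPower_real_Ioi S.K_zero_nonneg (by positivity), forwardQ]
  congr 2
  ring

@[fun_prop]
lemma measurable_forwardQ : Measurable S.forwardQ := by
  simp only [funext S.forwardQ_eq]
  exact (measurable_ricianPower_real_Ioi S.K_zero_nonneg).comp (by fun_prop)

lemma forwardQ_mem (x : ℂ) : S.forwardQ x ∈ Icc (0 : ℝ) 1 := by
  rw [forwardQ_eq]
  exact ricianPower_real_Ioi_mem S.K_zero_nonneg _

lemma dist_polar_dest (r φ : ℝ) :
    dist ((r : ℂ) * Complex.exp ((φ : ℂ) * Complex.I)) S.dest =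
      Real.sqrt (r ^ 2 + S.rD ^ 2 - 2 * r * S.rD * Real.cos (φ - S.φD)) := by
  rw [dest, Complex.dist_eq_re_im]
  congr 1
  simp only [Complex.re_ofReal_mul, Complex.im_ofReal_mul, Complex.exp_ofReal_mul_I_re,
    Complex.exp_ofReal_mul_I_im, Real.cos_sub]
  linear_combination r ^ 2 * Real.sin_sq_add_cos_sq φ + S.rD ^ 2 * Real.sin_sq_add_cos_sq S.φD

lemma QRD_eq (r φ : ℝ) :
    S.QRD r φ = S.forwardQ ((r : ℂ) * Complex.exp ((φ : ℂ) * Complex.I)) := by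
  rw [forwardQ, dist_polar_dest]
  rfl

lemma QUR_eq {r : ℝ} (hr : 0 < r) : S.QUR r = S.decodeProb (r : ℂ) := by
  rw [S.decodeProb_eq (by exact_mod_cast hr.ne'), Complex.norm_of_nonneg hr.le]

/-- The average number of relays that decode and reach the destination, per unit density, in
polar coordinates. -/
lemma setIntegral_decode_forward :
    ∫ x in Metric.closedBall (0 : ℂ) S.rC, S.decodeProb x * S.forwardProb x =
      ∫ p in Ioo (-Real.pi) Real.pi ×ˢ Ioc 0 S.rC, p.2 * S.QRD p.2 p.1 * S.QUR p.2 := by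
  -- The two exceptional points, the origin and the destination, are Lebesgue null.
  have hae : ∀ᵐ x : ℂ, S.decodeProb x * S.forwardProb x = S.QUR ‖x‖ * S.forwardQ x := by
    filter_upwards [Measure.ae_ne volume 0, Measure.ae_ne volume S.dest] with x h0 hd
    rw [S.decodeProb_eq h0, S.forwardProb_eq hd]
  have hset : Ioo (-Real.pi) Real.pi ×ˢ Ioc 0 S.rC =
      Prod.swap ⁻¹' (polarCoord.target ∩ {p | p.1 ≤ S.rC}) := by
    ext ⟨φ, r⟩
    simp only [polarCoord_target, mem_prod, mem_Ioo, mem_Ioc, mem_preimage, Prod.swap_prod_mk,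
      mem_inter_iff, mem_Ioi, mem_ofPred_eq]
    tauto
  have hswap := (Measure.measurePreserving_swap (μ := (volume : Measure ℝ))
    (ν := (volume : Measure ℝ))).setIntegral_preimage_emb
      MeasurableEquiv.prodComm.measurableEmbedding
      (fun p : ℝ × ℝ => p.1 * S.QRD p.1 p.2 * S.QUR p.1) (polarCoord.target ∩ {p | p.1 ≤ S.rC})
  simp only [Prod.fst_swap, Prod.snd_swap, ← Measure.volume_eq_prod] at hswap
  rw [setIntegral_congr_ae measurableSet_closedBall (hae.mono fun x hx _ => hx),
    ← integral_indicator measurableSet_closedBall, ← Complex.integral_comp_polarCoord_symm, hset,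
    hswap,
    ← setIntegral_indicator (measurableSet_le measurable_fst measurable_const)]
  refine setIntegral_congr_fun polarCoord.open_target.measurableSet fun p hp => ?_
  have hr : 0 < p.1 := hp.1
  have hpolar : Complex.polarCoord.symm p = (p.1 : ℂ) * Complex.exp ((p.2 : ℂ) * Complex.I) := by
    rw [Complex.polarCoord_symm_apply, Complex.exp_mul_I, Complex.ofReal_cos, Complex.ofReal_sin]
  have hnorm : ‖Complex.polarCoord.symm p‖ = p.1 := by
    rw [Complex.norm_polarCoord_symm, abs_of_pos hr]
  have hmem : Complex.polarCoord.symm p ∈ Metric.closedBall (0 : ℂ) S.rC ↔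
      p ∈ {p : ℝ × ℝ | p.1 ≤ S.rC} := by rw [mem_closedBall_zero_iff, hnorm, mem_ofPred_eq]
  by_cases hle : p ∈ {p : ℝ × ℝ | p.1 ≤ S.rC}
  · rw [indicator_of_mem (hmem.2 hle), indicator_of_mem hle, hnorm, hpolar,
      ← QRD_eq, smul_eq_mul]
    ring
  · rw [indicator_of_notMem (hmem.not.2 hle), indicator_of_notMem hle, smul_zero]

lemma measurable_QRD : Measurable fun p : ℝ × ℝ => S.QRD p.2 p.1 := by
  simp only [QRD_eq]
  exact S.measurable_forwardQ.comp (by fun_prop)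

lemma measurable_QRD_left (φ : ℝ) : Measurable fun r => S.QRD r φ := by
  simp only [QRD_eq]
  exact S.measurable_forwardQ.comp (by fun_prop)

/-- On positive radii `QUR` is the measurable function `decodeProb`, and the product is bounded by
`S.rC`. A general `β` covers both the radial and the two-variable integrals. -/
lemma integrable_mul_QUR {β : Type*} [MeasurableSpace β] {ν : Measure β} [IsFiniteMeasure ν]
    {r c : β → ℝ} (hr : Measurable r) (hc : Measurable c) (hr' : ∀ᵐ b ∂ν, r b ∈ Ioc 0 S.rC)
    (hc' : ∀ b, c b ∈ Icc (0 : ℝ) 1) : Integrable (fun b => r b * c b * S.QUR (r b)) ν := by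
  have h : Integrable (fun b => r b * c b * S.decodeProb (r b)) ν := by
    refine Integrable.of_bound (C := S.rC) (Measurable.aestronglyMeasurable (by fun_prop)) ?_
    filter_upwards [hr'] with b hb
    obtain ⟨h0, h1⟩ := S.decodeProb_mem (r b)
    obtain ⟨h2, h3⟩ := hc' b
    have := hb.1
    rw [Real.norm_of_nonneg (by positivity)]
    exact (mul_le_of_le_one_right (by positivity) h1).trans
      ((mul_le_of_le_one_right hb.1.le h3).trans hb.2)
  refine h.congr (hr'.mono fun b hb => ?_)
  simp only [S.QUR_eq hb.1]

lemma QRD_mem (r φ : ℝ) : S.QRD r φ ∈ Icc (0 : ℝ) 1 := by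
  rw [QRD_eq]
  exact S.forwardQ_mem _

/-- The integral over the disk is the difference of the two integrals in polar coordinates. -/
lemma setIntegral_decode_forward_eq_ψ1_sub_ψ2 :
    ∫ x in Metric.closedBall (0 : ℂ) S.rC, S.decodeProb x * S.forwardProb x = S.ψ1 - S.ψ2 := by
  let g : ℝ → ℝ := fun φ => ∫ r in (0 : ℝ)..S.rC, r * S.QRD r φ * S.QUR r
  have hFint : ∀ s : Set ℝ, volume s ≠ ⊤ → Integrable
      (fun p : ℝ × ℝ => p.2 * S.QRD p.2 p.1 * S.QUR p.2)
      ((volume.restrict s).prod (volume.restrict (Ioc 0 S.rC))) := fun s hs => by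
    have : IsFiniteMeasure (volume.restrict s) := isFiniteMeasure_restrict.2 hs
    refine S.integrable_mul_QUR measurable_snd S.measurable_QRD ?_ fun p => S.QRD_mem _ _
    exact Measure.quasiMeasurePreserving_snd.ae (ae_restrict_mem measurableSet_Ioc)
  have hg : IntervalIntegrable g volume 0 (2 * Real.pi) := by
    rw [intervalIntegrable_iff_integrableOn_Ioc_of_le (by positivity)]
    refine (hFint (Ioc 0 (2 * Real.pi)) measure_Ioc_lt_top.ne).integral_prod_left.congr (.of_forall fun φ => ?_)
    exact (intervalIntegral.integral_of_le S.rC_nonneg).symm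
  have hrad : ∀ c : ℝ → ℝ, Measurable c → (∀ r, c r ∈ Icc (0 : ℝ) 1) →
      IntervalIntegrable (fun r => r * c r * S.QUR r) volume 0 S.rC := fun c hc hc' => by
    rw [intervalIntegrable_iff_integrableOn_Ioc_of_le S.rC_nonneg]
    exact S.integrable_mul_QUR measurable_id hc (ae_restrict_mem measurableSet_Ioc) hc'
  -- Polar coordinates use angles in `(-π, π)` and `ψ2` uses `(0, 2π)`; periodicity reconciles them.
  have hper : Function.Periodic g (2 * Real.pi) := fun φ => by
    simp only [g, QRD, add_sub_right_comm, Real.cos_add_two_pi]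
  have hleft : ∫ x in Metric.closedBall (0 : ℂ) S.rC, S.decodeProb x * S.forwardProb x =
      ∫ φ in (0 : ℝ)..(2 * Real.pi), g φ := by
    have hshift := hper.intervalIntegral_add_eq (-Real.pi) 0
    rw [show -Real.pi + 2 * Real.pi = Real.pi by ring, zero_add] at hshift
    rw [setIntegral_decode_forward, ← hshift, intervalIntegral.integral_of_le (by linarith [Real.pi_pos]),
      integral_Ioc_eq_integral_Ioo, Measure.volume_eq_prod, ← Measure.prod_restrict,
      MeasureTheory.integral_prod _ (hFint _ measure_Ioo_lt_top.ne)]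
    simp only [g, intervalIntegral.integral_of_le S.rC_nonneg]
  -- The first radial integral does not depend on `φ`, so integrating it over the circle gives `ψ1`.
  have hψ2 : S.ψ2 = ∫ φ in (0 : ℝ)..(2 * Real.pi), ((∫ r in (0 : ℝ)..S.rC, r * S.QUR r) - g φ) := by
    refine intervalIntegral.integral_congr fun φ _ => ?_
    have h1 := hrad (fun _ => 1) measurable_const (by simp)
    simp only [mul_one] at h1
    have h2 := hrad (fun r => S.QRD r φ)
      (S.measurable_QRD_left φ) fun r => S.QRD_mem r φ
    simp only [g]
    rw [← intervalIntegral.integral_sub h1 h2]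
    refine intervalIntegral.integral_congr fun r _ => ?_
    ring
  rw [hleft, hψ2, intervalIntegral.integral_sub intervalIntegrable_const hg,
    intervalIntegral.integral_const, ψ1, smul_eq_mul]
  ring

end RelayNetwork

end

theorem mainTheorem1 {Ω : Type*} [MeasurableSpace Ω] (P : Measure Ω) [IsProbabilityMeasure P]
    (S : RelayNetwork) (N : Ω → ℕ) (X : ℕ → Ω → ℂ) (U V : ℕ → Ω → ℝ) (J : Ω → ℕ)
    (hreal : S.IsRealization P N X U V) (hJ : S.IsBestRelay N X U V J) :
    P.real {ω | S.relayedSNR N X U V J ω ≤ S.ξ} = Real.exp (-S.lam * (S.ψ1 - S.ψ2)) := by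
  rw [hreal.outage_eq_exp hJ, RelayNetwork.intensity, integral_smul_measure,
    ENNReal.toReal_ofReal S.lam_nonneg, S.setIntegral_decode_forward_eq_ψ1_sub_ψ2, smul_eq_mul,
    neg_mul]
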